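/- Setting. Let $d,q,k\in\mathbb N$, let $\mathcal T$ be a $k$-dimensional simplicial complex in $\mathbb R^d$, let $\mathcal S$ be a finite set of $k$-simplices of $\mathcal T$, and let $U=\bigcup_{\tau\in\mathcal S}\tau$, equipped with the $k$-dimensional volume $d\mathbf x$. $L^2(U;\mathbb R^q)$ carries the inner product $(\mathbf u,\mathbf w)=\int_U\mathbf u^{\rm T}\mathbf w\,d\mathbf x$. Let $(\Omega,\mathcal F,\mathbb P)$ be a probability space and let $\mathbf v\in L^2_{\mathbb P}(\Omega;L^2(U;\mathbb R^q))$ be a random field, with jointly measurable values $\mathbf v(\mathbf x,\omega)$ and mean $\mathbb E[\mathbf v]=\mathbf 0$. Let $(\lambda_i,\phi_i)_{i\ge1}$ be the eigensystem defining its Karhunen-Loève expansion $\mathbf v=\sum_{i\ge1}\lambda_i^{1/2}\phi_iY_i$: $(\phi_i)$ is orthonormal in $L^2(U;\mathbb R^q)$, $\lambda_1\ge\lambda_2\ge\dots\ge0$, and the covariance operator $(\mathcal C_{\mathbf v}\mathbf u)(\mathbf x)=\int_U{\rm Cov}(\mathbf v(\mathbf x),\mathbf v(\mathbf y))\,\mathbf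 u(\mathbf y)\,d\mathbf y$ satisfies $\mathcal C_{\mathbf v}\phi_i=\lambda_i\phi_i$ and $\mathcal C_{\mathbf v}\mathbf u=\sum_i\lambda_i(\mathbf u,\phi_i)\phi_i$ for all $\mathbf u\in L^2(U;\mathbb R^q)$. Fix an integer $M\ge0$. Multilevel basis. Let $\boldsymbol\chi^j_\tau=c^j_\tau 1_\tau e_j$ ($\tau\in\mathcal S$, $1\le j\le q$), where $e_j$ is the $j$-th standard unit vector of $\mathbb R^q$ and the constants $c^j_\tau$ are such that these functions are orthonormal in $L^2(U;\mathbb R^q)$. Let a finite binary tree of cells be built by recursively bisecting the set of barycenters of the simplices in $\mathcal S$: the root contains all barycenters, a cell with fewer than $n_0$ barycenters is a leaf, and every other cell is split in two by some rule on the barycenters (for instance the median rule in the coordinate direction of maximal variance, which gives a kd-tree). From the leaves to the root, each cell receives a finite list $\mathcal E=(e_1,\dots,e_s)$ of functions: for a leaf, all $\boldsymbol\chi^j_\tau$ with $\tau$ in the cell; for any other cell, the functions $\boldsymbol\phi_j$ (see below) of its two children, in any order. Let $\mathbf M=((\phi_i,e_j))_{1\le i\le M,\,1\le j\le s}$ have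 rank $a$ and singular value decomposition $\mathbf M=\mathbf U\mathbf D\mathbf V^{\rm T}$ (non-increasing singular values, $\mathbf U,\mathbf V$ orthogonal), and put $\boldsymbol\phi_j=\sum_i\mathbf V_{ij}e_i$ for $j\le a$ and $\boldsymbol\psi_j=\sum_i\mathbf V_{ij}e_i$ for $a<j\le s$. Write $\boldsymbol\psi^{l,k'}_p$, $a<p\le s$, for the functions $\boldsymbol\psi_p$ obtained in the $k'$-th cell at level $l$. Lemma. The series $\sum_{i\ge M+1}\lambda_i$ converges, and for every $l\ge0$, every cell at level $l$ and every function $\boldsymbol\psi^{l,k'}_p$ of that cell, the projection coefficient $$d^{l,k'}_p(\omega)=\int_U\mathbf v(\mathbf x,\omega)^{\rm T}\boldsymbol\psi^{l,k'}_p(\mathbf x)\,d\mathbf x$$ is square integrable on $\Omega$ and satisfies $$\mathbb E\big[d^{l,k'}_p\big]=0\qquad\text{and}\qquad\mathbb E\big[(d^{l,k'}_p)^2\big]\le\sum_{i\ge M+1}\lambda_i .$$ -/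

import Mathlib

open MeasureTheory ProbabilityTheory
open scoped ENNReal

noncomputable section

namespace MultilevelKL

/-! ### Domains made of simplices -/

/-- The union of the (closed) simplices with vertex sets in `𝒮`. -/
def domain {d : ℕ} (𝒮 : Finset (Finset (EuclideanSpace ℝ (Fin d)))) :
    Set (EuclideanSpace ℝ (Fin d)) :=
  ⋃ τ ∈ 𝒮, convexHull ℝ (τ : Set (EuclideanSpace ℝ (Fin d)))

/-- The `k`-dimensional volume on the domain, i.e. the measure `dx` on `U`. The Euclidean Hausdorff
measure `μHE[k]` is normalised to be Lebesgue measure when `k = d`. -/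
def domainMeasure {d : ℕ} (k : ℕ) (𝒮 : Finset (Finset (EuclideanSpace ℝ (Fin d)))) :
    Measure (EuclideanSpace ℝ (Fin d)) :=
  (Measure.euclideanHausdorffMeasure k).restrict (domain 𝒮)

/-- `L²(μ; ℝ^q)`; its inner product is `(u, w) = ∫ uᵀ w dμ`. -/
abbrev L2 {d : ℕ} (μ : Measure (EuclideanSpace ℝ (Fin d))) (q : ℕ) : Type :=
  Lp (EuclideanSpace ℝ (Fin q)) 2 μ

/-! ### Random fields, covariance operator, Karhunen-Loève eigensystem -/

section KL

variable {Ω : Type*} [MeasurableSpace Ω] {d q : ℕ}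

/-- `v ∈ L²_P(Ω; L²(μ; ℝ^q))`, and `f ω x = v(x, ω)` are (jointly measurable) pointwise values
of `v`. -/
structure IsRandomField (P : Measure Ω) (μ : Measure (EuclideanSpace ℝ (Fin d)))
    (v : Ω → L2 μ q) (f : Ω → EuclideanSpace ℝ (Fin d) → EuclideanSpace ℝ (Fin q)) : Prop where
  memLp : MemLp v 2 P
  measurable : AEStronglyMeasurable (Function.uncurry f) (P.prod μ)
  values : ∀ᵐ ω ∂P, v ω =ᵐ[μ] f ω

/-- The mean `E[v](x) = (E[v_1(x, ·)], …, E[v_q(x, ·)])`. -/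
def mean (P : Measure Ω) (f : Ω → EuclideanSpace ℝ (Fin d) → EuclideanSpace ℝ (Fin q))
    (x : EuclideanSpace ℝ (Fin d)) : EuclideanSpace ℝ (Fin q) :=
  WithLp.toLp 2 fun i => ∫ ω, f ω x i ∂P

/-- The matrix-valued covariance function `Cov(v(x), v(y))`. -/
def covFn (P : Measure Ω) (f : Ω → EuclideanSpace ℝ (Fin d) → EuclideanSpace ℝ (Fin q))
    (x y : EuclideanSpace ℝ (Fin d)) : Matrix (Fin q) (Fin q) ℝ :=
  Matrix.of fun i j => covariance (fun ω => f ω x i) (fun ω => f ω y j) P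

/-- The covariance operator `(C_v u)(x) = ∫_U Cov(v(x), v(y)) u(y) dy`. -/
def covOp (P : Measure Ω) (μ : Measure (EuclideanSpace ℝ (Fin d)))
    (f : Ω → EuclideanSpace ℝ (Fin d) → EuclideanSpace ℝ (Fin q)) (u : L2 μ q)
    (x : EuclideanSpace ℝ (Fin d)) : EuclideanSpace ℝ (Fin q) :=
  ∫ y, WithLp.toLp 2 ((covFn P f x y).mulVec (u y)) ∂μ

/-- `(lam k, φ k)` is the eigensystem of the covariance operator that defines the Karhunen-Loève
expansion of the random field; indices start at `0`. -/
structure IsKLEigensystem (P : Measure Ω) (μ : Measure (EuclideanSpace ℝ (Fin d)))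
    (f : Ω → EuclideanSpace ℝ (Fin d) → EuclideanSpace ℝ (Fin q))
    (lam : ℕ → ℝ) (φ : ℕ → L2 μ q) : Prop where
  orthonormal : Orthonormal ℝ φ
  antitone : Antitone lam
  nonneg : ∀ k, 0 ≤ lam k
  eigen : ∀ k, covOp P μ f (φ k) =ᵐ[μ] fun x => lam k • φ k x
  spectral : ∀ u : L2 μ q, ∃ w : L2 μ q, covOp P μ f u =ᵐ[μ] w ∧
    HasSum (fun k => (lam k * inner ℝ u (φ k)) • φ k) w

end KL

/-! ### The multilevel basis -/

/-- `A = U D Vᵀ` is a singular value decomposition: `U`, `V` orthogonal, `D` rectangular diagonal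
with non-negative, non-increasing diagonal. -/
structure IsSVD {m n : ℕ} (A : Matrix (Fin m) (Fin n) ℝ) (U : Matrix (Fin m) (Fin m) ℝ)
    (D : Matrix (Fin m) (Fin n) ℝ) (V : Matrix (Fin n) (Fin n) ℝ) : Prop where
  left_mem : U ∈ Matrix.orthogonalGroup (Fin m) ℝ
  right_mem : V ∈ Matrix.orthogonalGroup (Fin n) ℝ
  off_diag : ∀ (i : Fin m) (j : Fin n), (i : ℕ) ≠ (j : ℕ) → D i j = 0
  diag_nonneg : ∀ (i : Fin m) (j : Fin n), (i : ℕ) = (j : ℕ) → 0 ≤ D i j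
  diag_antitone : ∀ (i i' : Fin m) (j j' : Fin n), (i : ℕ) = (j : ℕ) → (i' : ℕ) = (j' : ℕ) →
    i ≤ i' → D i' j' ≤ D i j
  eq : A = U * D * V.transpose

/-- A cell of the tree: the simplices whose barycenters it contains, the list of functions entering
the orthogonalisation in this cell, and the two lists which the orthogonalisation returns. -/
structure Cell (S H : Type*) where
  simplices : Finset S
  input : List H
  scaling : List H
  wavelets : List H

/-- Finite binary trees of cells. -/
inductive CellTree (S H : Type*) where
  | leaf (B : Cell S H) : CellTree S H
  | node (B : Cell S H) (left right : CellTree S H) : CellTree S H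

namespace CellTree

variable {S H : Type*}

/-- The cell at the root. -/
def root : CellTree S H → Cell S H
  | leaf B => B
  | node B _ _ => B

/-- The cells at level `l`. -/
def cellsAt : CellTree S H → ℕ → Set (Cell S H)
  | leaf B, 0 => {B}
  | leaf _, _ + 1 => ∅
  | node B _ _, 0 => {B}
  | node _ L R, l + 1 => L.cellsAt l ∪ R.cellsAt l

end CellTree

section Basis

variable {H : Type*} [NormedAddCommGroup H] [InnerProductSpace ℝ H]

/-- The linear combinations `∑ i, V i j • e_i` of the entries `e_i` of the list `e`, one for every
column `j` of `V`. -/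
def combine (e : List H) (V : Matrix (Fin e.length) (Fin e.length) ℝ) : List H :=
  List.ofFn fun j => ∑ i, V i j • e.get i

/-- One orthogonalisation step: `V` comes from a singular value decomposition of the matrix
`((φ_i, e_j))_{i, j}` (`i < M`) of rank `a`; its first `a` columns give the functions in `scaling`
and the remaining ones the functions in `wavelets`. -/
def IsOrthogonalised {S : Type*} (M : ℕ) (φ : ℕ → H) (B : Cell S H) : Prop :=
  ∃ (A : Matrix (Fin M) (Fin B.input.length) ℝ) (U : Matrix (Fin M) (Fin M) ℝ)
    (D : Matrix (Fin M) (Fin B.input.length) ℝ)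
    (V : Matrix (Fin B.input.length) (Fin B.input.length) ℝ),
    (∀ i j, A i j = inner ℝ (φ i) (B.input.get j)) ∧ IsSVD A U D V ∧
    B.scaling = (combine B.input V).take A.rank ∧
    B.wavelets = (combine B.input V).drop A.rank

open Classical in
/-- The tree is built by recursive bisection of sets of barycenters, and its cells carry the
multilevel basis. A cell with fewer than `n₀` barycenters is a leaf, every other one is split
by some rule (for a kd-tree: `x ↦ x i ≤ median` in the direction `i` of maximal variance).
The input of a leaf consists of the functions `χ τ j` with `τ` in the cell; the input of any other
cell consists of the scaling functions of its two children. -/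
def IsMultilevelTree {d q : ℕ} (n₀ M : ℕ) (φ : ℕ → H)
    (χ : Finset (EuclideanSpace ℝ (Fin d)) → Fin q → H) :
    CellTree (Finset (EuclideanSpace ℝ (Fin d))) H → Prop
  | .leaf B =>
      B.simplices.card < n₀ ∧
      B.input.Perm ((B.simplices ×ˢ Finset.univ).toList.map fun p => χ p.1 p.2) ∧
      IsOrthogonalised M φ B
  | .node B L R =>
      n₀ ≤ B.simplices.card ∧
      (∃ rule : EuclideanSpace ℝ (Fin d) → Prop,
        L.root.simplices = B.simplices.filter (fun τ => rule (τ.centroid ℝ id)) ∧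
        R.root.simplices = B.simplices.filter (fun τ => ¬ rule (τ.centroid ℝ id))) ∧
      B.input.Perm (L.root.scaling ++ R.root.scaling) ∧
      IsOrthogonalised M φ B ∧
      IsMultilevelTree n₀ M φ χ L ∧ IsMultilevelTree n₀ M φ χ R

/-- The functions `χ τ j = c τ j • 1_τ • e_j`, `τ ∈ 𝒮`, `j < q`, form an orthonormal set. -/
structure IsIndicatorBasis {d q : ℕ} {μ : Measure (EuclideanSpace ℝ (Fin d))}
    (𝒮 : Finset (Finset (EuclideanSpace ℝ (Fin d))))
    (c : Finset (EuclideanSpace ℝ (Fin d)) → Fin q → ℝ)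
    (χ : Finset (EuclideanSpace ℝ (Fin d)) → Fin q → L2 μ q) : Prop where
  eq_indicator : ∀ τ ∈ 𝒮, ∀ j, χ τ j =ᵐ[μ]
    (convexHull ℝ (τ : Set (EuclideanSpace ℝ (Fin d)))).indicator
      fun _ => c τ j • EuclideanSpace.single j (1 : ℝ)
  orthonormal : Orthonormal ℝ fun p : 𝒮 × Fin q => χ p.1 p.2

end Basis

end MultilevelKL

end

/-!
The wavelets of a cell are combinations of its input functions along the columns of `V` beyond the
rank of `((φ_i, e_j))`, and these columns span the kernel of that matrix: every wavelet is
orthogonal to `φ_0, …, φ_{M-1}`. It also has norm one, since the input functions of a cell are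
orthonormal: the scaling functions of two siblings live on disjoint sets of simplices.

By Fubini, `E[v] = 0` gives `E[(v, ψ)] = 0` and `E[(v, ψ)²] = (C_v ψ, ψ) = ∑ λ_i (φ_i, ψ)²`. For a
wavelet `ψ` the first `M` terms vanish and the others are at most `λ_i`. The series `∑ λ_i`
converges because `λ_i = E[(v, φ_i)²]`, so that Bessel's inequality bounds it by `E[‖v‖²]`. Fubini
applies since `U` has finite volume: on a simplex of infinite volume the functions `χ` would
vanish, against `‖χ‖ = 1`.
-/

namespace MultilevelKL

/-! ### Singular value decompositions -/

theorem le_rank_of_diag_ne_zero {K : Type*} [Field K] {m n r : ℕ} {D : Matrix (Fin m) (Fin n) K}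
    (hm : r ≤ m) (hn : r ≤ n)
    (hoff : ∀ s t : Fin r, s ≠ t → D (s.castLE hm) (t.castLE hn) = 0)
    (hdiag : ∀ t : Fin r, D (t.castLE hm) (t.castLE hn) ≠ 0) : r ≤ D.rank := by
  have hblock : D.submatrix (Fin.castLE hm) (Fin.castLE hn) =
      Matrix.diagonal fun t => D (t.castLE hm) (t.castLE hn) := by
    ext s t
    obtain rfl | hst := eq_or_ne s t
    · rw [Matrix.diagonal_apply_eq, Matrix.submatrix_apply]
    · rw [Matrix.diagonal_apply_ne _ hst, Matrix.submatrix_apply, hoff s t hst]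
  have hunit : IsUnit (D.submatrix (Fin.castLE hm) (Fin.castLE hn)) := by
    rw [hblock, Matrix.isUnit_iff_isUnit_det, Matrix.det_diagonal, isUnit_iff_ne_zero]
    exact Finset.prod_ne_zero_iff.2 fun t _ => hdiag t
  simpa only [Matrix.rank_of_isUnit _ hunit, Fintype.card_fin] using
    Matrix.rank_submatrix_le D (Fin.castLE hm) (Fin.castLE hn)

namespace IsSVD

variable {m n : ℕ} {A : Matrix (Fin m) (Fin n) ℝ} {U : Matrix (Fin m) (Fin m) ℝ}
  {D : Matrix (Fin m) (Fin n) ℝ} {V : Matrix (Fin n) (Fin n) ℝ}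

theorem rank_eq (h : IsSVD A U D V) : A.rank = D.rank := by
  have hU : IsUnit U.det := Matrix.UnitaryGroup.det_isUnit ⟨U, h.left_mem⟩
  have hV : IsUnit V.transpose.det := by
    rw [Matrix.det_transpose]
    exact Matrix.UnitaryGroup.det_isUnit ⟨V, h.right_mem⟩
  rw [h.eq, Matrix.rank_mul_eq_left_of_isUnit_det _ _ hV,
    Matrix.rank_mul_eq_right_of_isUnit_det _ _ hU]

theorem apply_eq_zero_of_rank_le (h : IsSVD A U D V) (i : Fin m) {j : Fin n} (hj : A.rank ≤ j) :
    D i j = 0 := by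
  by_contra hne
  have hij : (i : ℕ) = j := by_contra fun hij => hne (h.off_diag i j hij)
  have hpos : 0 < D i j := (h.diag_nonneg i j hij).lt_of_ne' hne
  have hrank : (j : ℕ) + 1 ≤ D.rank := by
    have hjm : (j : ℕ) + 1 ≤ m := by omega
    refine le_rank_of_diag_ne_zero hjm j.isLt
      (fun s t hst => h.off_diag _ _ (Fin.val_ne_of_ne hst)) fun t => ?_
    have hti : Fin.castLE hjm t ≤ i := Fin.le_def.2 (by rw [Fin.val_castLE]; omega)
    exact (hpos.trans_le (h.diag_antitone _ _ _ _ rfl hij hti)).ne'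
  rw [← h.rank_eq] at hrank
  omega

theorem mul_right_eq (h : IsSVD A U D V) : A * V = U * D := by
  have hV : V.transpose * V = 1 := (Matrix.mem_orthogonalGroup_iff' _ _).1 h.right_mem
  rw [h.eq, Matrix.mul_assoc, hV, Matrix.mul_one]

theorem mul_right_apply_eq_zero (h : IsSVD A U D V) (i : Fin m) {j : Fin n} (hj : A.rank ≤ j) :
    (A * V) i j = 0 := by
  rw [h.mul_right_eq, Matrix.mul_apply]
  exact Finset.sum_eq_zero fun l _ => by rw [h.apply_eq_zero_of_rank_le l hj, mul_zero]

end IsSVD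

/-! ### Orthonormality and vanishing moments of the multilevel basis -/

section OrthonormalList

variable {H : Type*} [NormedAddCommGroup H] [InnerProductSpace ℝ H]

/-- A list of pairwise orthogonal unit vectors. Equivalent to `Orthonormal ℝ l.get`, but phrased
through `List.Pairwise`, which is stable under permutations, sublists and concatenation. -/
def OrthonormalList (l : List H) : Prop :=
  l.Pairwise (fun x y => inner ℝ x y = 0) ∧ ∀ x ∈ l, ‖x‖ = 1

namespace OrthonormalList

variable {l l' : List H}

theorem perm (h : OrthonormalList l) (hp : l.Perm l') : OrthonormalList l' :=
  ⟨hp.pairwise h.1 fun hxy => inner_eq_zero_symm.1 hxy, fun x hx => h.2 x (hp.mem_iff.2 hx)⟩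

theorem sublist (h : OrthonormalList l) (hs : l'.Sublist l) : OrthonormalList l' :=
  ⟨h.1.sublist hs, fun x hx => h.2 x (hs.subset hx)⟩

theorem append (h : OrthonormalList l) (h' : OrthonormalList l')
    (hll' : ∀ x ∈ l, ∀ y ∈ l', inner ℝ x y = 0) : OrthonormalList (l ++ l') :=
  ⟨List.pairwise_append.2 ⟨h.1, h'.1, hll'⟩,
    fun x hx => (List.mem_append.1 hx).elim (h.2 x) (h'.2 x)⟩

theorem orthonormal_get (h : OrthonormalList l) : Orthonormal ℝ l.get := by
  refine ⟨fun i => h.2 _ (List.get_mem l i), fun i j hij => ?_⟩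
  rcases lt_or_gt_of_ne hij with hlt | hgt
  · exact List.pairwise_iff_get.1 h.1 i j hlt
  · exact inner_eq_zero_symm.1 (List.pairwise_iff_get.1 h.1 j i hgt)

end OrthonormalList

theorem orthonormalList_ofFn {n : ℕ} {g : Fin n → H} (hg : Orthonormal ℝ g) :
    OrthonormalList (List.ofFn g) :=
  ⟨List.pairwise_ofFn.2 fun _ _ hij => hg.2 hij.ne,
    fun _ hx => by obtain ⟨i, rfl⟩ := List.mem_ofFn.1 hx; exact hg.1 i⟩

theorem orthonormalList_map_toList {ι : Type*} {s : Finset ι} {g : ι → H}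
    (hg : Orthonormal ℝ fun i : s => g i) : OrthonormalList (s.toList.map g) := by
  constructor
  · refine List.pairwise_map.2 (s.nodup_toList.imp_of_mem fun hi hj hij => ?_)
    exact hg.2 (i := ⟨_, Finset.mem_toList.1 hi⟩) (j := ⟨_, Finset.mem_toList.1 hj⟩)
      fun h => hij (Subtype.ext_iff.1 h)
  · rintro x hx
    obtain ⟨i, hi, rfl⟩ := List.mem_map.1 hx
    exact hg.1 ⟨i, Finset.mem_toList.1 hi⟩

theorem OrthonormalList.combine {e : List H} (he : OrthonormalList e)
    {V : Matrix (Fin e.length) (Fin e.length) ℝ}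
    (hV : V ∈ Matrix.orthogonalGroup (Fin e.length) ℝ) : OrthonormalList (combine e V) := by
  refine orthonormalList_ofFn (orthonormal_iff_ite.2 fun j j' => ?_)
  have hVV : (star V * V) j j' = (1 : Matrix _ _ ℝ) j j' :=
    congrFun₂ ((Matrix.mem_orthogonalGroup_iff' _ _).1 hV) j j'
  rw [he.orthonormal_get.inner_sum]
  simpa [Matrix.mul_apply, Matrix.one_apply] using hVV

theorem mem_of_mem_combine {e : List H} {V : Matrix (Fin e.length) (Fin e.length) ℝ}
    {K : Submodule ℝ H} (hK : ∀ x ∈ e, x ∈ K) {x : H} (hx : x ∈ combine e V) : x ∈ K := by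
  obtain ⟨j, rfl⟩ := List.mem_ofFn.1 hx
  exact K.sum_mem fun i _ => K.smul_mem _ (hK _ (List.get_mem e i))

end OrthonormalList

namespace IsOrthogonalised

variable {H S : Type*} [NormedAddCommGroup H] [InnerProductSpace ℝ H] {M : ℕ} {φ : ℕ → H}
  {B : Cell S H}

theorem inner_wavelet_eq_zero (h : IsOrthogonalised M φ B) {ψ : H} (hψ : ψ ∈ B.wavelets) {i : ℕ}
    (hi : i < M) : inner ℝ (φ i) ψ = 0 := by
  obtain ⟨A, U, D, V, hA, hsvd, -, hw⟩ := h
  rw [hw] at hψ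
  obtain ⟨t, ht, rfl⟩ := List.mem_drop_iff_getElem.1 hψ
  have hlen : A.rank + t < B.input.length := by
    simpa only [combine, List.length_ofFn, add_comm] using ht
  have hker : (A * V) ⟨i, hi⟩ ⟨A.rank + t, hlen⟩ = 0 :=
    hsvd.mul_right_apply_eq_zero _ (Nat.le_add_right _ _)
  simp only [combine, List.getElem_ofFn, inner_sum, inner_smul_right]
  simpa only [Matrix.mul_apply, hA, mul_comm] using hker

theorem orthonormalList_scaling (h : IsOrthogonalised M φ B) (hB : OrthonormalList B.input) :
    OrthonormalList B.scaling := by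
  obtain ⟨A, U, D, V, -, hsvd, hs, -⟩ := h
  exact hs ▸ (hB.combine hsvd.right_mem).sublist (List.take_sublist _ _)

theorem orthonormalList_wavelets (h : IsOrthogonalised M φ B) (hB : OrthonormalList B.input) :
    OrthonormalList B.wavelets := by
  obtain ⟨A, U, D, V, -, hsvd, -, hw⟩ := h
  exact hw ▸ (hB.combine hsvd.right_mem).sublist (List.drop_sublist _ _)

theorem mem_of_mem_scaling (h : IsOrthogonalised M φ B) {K : Submodule ℝ H}
    (hK : ∀ x ∈ B.input, x ∈ K) {x : H} (hx : x ∈ B.scaling) : x ∈ K := by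
  obtain ⟨A, U, D, V, -, -, hs, -⟩ := h
  exact mem_of_mem_combine hK (List.mem_of_mem_take (hs ▸ hx))

end IsOrthogonalised

section CellSpan

variable {H S ι : Type*} [NormedAddCommGroup H] [InnerProductSpace ℝ H] {χ : S → ι → H}
  {𝒮 𝒮₁ 𝒮₂ : Finset S}

/-- The functions living on the simplices in `𝒮`: the span of the `χ τ j` with `τ ∈ 𝒮`. -/
def cellSpan (χ : S → ι → H) (𝒮 : Finset S) : Submodule ℝ H :=
  Submodule.span ℝ (Set.image2 χ 𝒮 Set.univ)

theorem mem_cellSpan {τ : S} (hτ : τ ∈ 𝒮) (j : ι) : χ τ j ∈ cellSpan χ 𝒮 :=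
  Submodule.subset_span (Set.mem_image2_of_mem hτ (Set.mem_univ j))

theorem cellSpan_mono (h : 𝒮₁ ⊆ 𝒮₂) : cellSpan χ 𝒮₁ ≤ cellSpan χ 𝒮₂ :=
  Submodule.span_mono (Set.image2_subset (Finset.coe_subset.2 h) subset_rfl)

theorem orthonormal_restrict (hχ : Orthonormal ℝ fun p : 𝒮 × ι => χ p.1 p.2) (h : 𝒮₁ ⊆ 𝒮) :
    Orthonormal ℝ fun p : 𝒮₁ × ι => χ p.1 p.2 :=
  hχ.comp (Prod.map (Set.inclusion h) id)
    ((Set.inclusion_injective h).prodMap Function.injective_id)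

theorem orthonormalList_map_product [Fintype ι] (hχ : Orthonormal ℝ fun p : 𝒮 × ι => χ p.1 p.2) :
    OrthonormalList ((𝒮 ×ˢ (Finset.univ : Finset ι)).toList.map fun p => χ p.1 p.2) := by
  refine orthonormalList_map_toList (g := fun p : S × ι => χ p.1 p.2) (hχ.comp
    (fun p : ↥(𝒮 ×ˢ (Finset.univ : Finset ι)) =>
      (⟨p.1.1, (Finset.mem_product.1 p.2).1⟩, p.1.2)) fun p p' hpp' => ?_)
  simp only [Prod.mk.injEq, Subtype.mk.injEq] at hpp'
  exact Subtype.ext (Prod.ext hpp'.1 hpp'.2)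

theorem isOrtho_cellSpan (hχ : Orthonormal ℝ fun p : 𝒮 × ι => χ p.1 p.2) (h₁ : 𝒮₁ ⊆ 𝒮)
    (h₂ : 𝒮₂ ⊆ 𝒮) (hdisj : Disjoint 𝒮₁ 𝒮₂) : cellSpan χ 𝒮₁ ⟂ cellSpan χ 𝒮₂ := by
  refine Submodule.isOrtho_span.2 ?_
  rintro _ ⟨τ, hτ, j, -, rfl⟩ _ ⟨τ', hτ', j', -, rfl⟩
  refine hχ.2 (i := (⟨τ, h₁ hτ⟩, j)) (j := (⟨τ', h₂ hτ'⟩, j')) fun h => ?_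
  exact Finset.disjoint_iff_ne.1 hdisj τ hτ τ' hτ' (Subtype.ext_iff.1 (Prod.ext_iff.1 h).1)

end CellSpan

namespace IsMultilevelTree

variable {H : Type*} [NormedAddCommGroup H] [InnerProductSpace ℝ H] {d q n₀ M : ℕ} {φ : ℕ → H}
  {χ : Finset (EuclideanSpace ℝ (Fin d)) → Fin q → H}

theorem isOrthogonalised_root {tree : CellTree (Finset (EuclideanSpace ℝ (Fin d))) H}
    (h : IsMultilevelTree n₀ M φ χ tree) : IsOrthogonalised M φ tree.root := by
  cases tree with
  | leaf B => exact h.2.2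
  | node B L R => exact h.2.2.2.1

theorem exists_subtree {tree : CellTree (Finset (EuclideanSpace ℝ (Fin d))) H}
    (h : IsMultilevelTree n₀ M φ χ tree) {l : ℕ} {B : Cell (Finset (EuclideanSpace ℝ (Fin d))) H}
    (hB : B ∈ tree.cellsAt l) :
    ∃ t, IsMultilevelTree n₀ M φ χ t ∧ t.root = B ∧ B.simplices ⊆ tree.root.simplices := by
  classical
  induction tree generalizing l with
  | leaf C =>
    cases l with
    | zero => obtain rfl : B = C := hB; exact ⟨_, h, rfl, subset_rfl⟩
    | succ l => exact absurd hB (Set.notMem_empty B)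
  | node C L R ihL ihR =>
    cases l with
    | zero => obtain rfl : B = C := hB; exact ⟨_, h, rfl, subset_rfl⟩
    | succ l =>
      obtain ⟨-, ⟨rule, hL, hR⟩, -, -, htL, htR⟩ := h
      rcases hB with hB | hB
      · obtain ⟨t, ht, hroot, hsub⟩ := ihL htL hB
        exact ⟨t, ht, hroot, hsub.trans (hL ▸ Finset.filter_subset _ _)⟩
      · obtain ⟨t, ht, hroot, hsub⟩ := ihR htR hB
        exact ⟨t, ht, hroot, hsub.trans (hR ▸ Finset.filter_subset _ _)⟩

theorem mem_cellSpan_of_mem_input {tree : CellTree (Finset (EuclideanSpace ℝ (Fin d))) H}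
    (h : IsMultilevelTree n₀ M φ χ tree) {x : H} (hx : x ∈ tree.root.input) :
    x ∈ cellSpan χ tree.root.simplices := by
  classical
  induction tree generalizing x with
  | leaf B =>
    obtain ⟨-, hinput, -⟩ := h
    obtain ⟨p, hp, rfl⟩ := List.mem_map.1 (hinput.mem_iff.1 hx)
    exact mem_cellSpan (Finset.mem_product.1 (Finset.mem_toList.1 hp)).1 p.2
  | node B L R ihL ihR =>
    obtain ⟨-, ⟨rule, hL, hR⟩, hinput, -, htL, htR⟩ := h
    rcases List.mem_append.1 (hinput.mem_iff.1 hx) with hx | hx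
    · exact cellSpan_mono (hL ▸ Finset.filter_subset _ _)
        (htL.isOrthogonalised_root.mem_of_mem_scaling (fun _ => ihL htL) hx)
    · exact cellSpan_mono (hR ▸ Finset.filter_subset _ _)
        (htR.isOrthogonalised_root.mem_of_mem_scaling (fun _ => ihR htR) hx)

theorem orthonormalList_input {tree : CellTree (Finset (EuclideanSpace ℝ (Fin d))) H}
    (h : IsMultilevelTree n₀ M φ χ tree)
    (hχ : Orthonormal ℝ fun p : tree.root.simplices × Fin q => χ p.1 p.2) :
    OrthonormalList tree.root.input := by
  classical
  induction tree with
  | leaf B => exact (orthonormalList_map_product hχ).perm h.2.1.symm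
  | node B L R ihL ihR =>
    obtain ⟨-, ⟨rule, hL, hR⟩, hinput, -, htL, htR⟩ := h
    have hLB : L.root.simplices ⊆ B.simplices := hL ▸ Finset.filter_subset _ _
    have hRB : R.root.simplices ⊆ B.simplices := hR ▸ Finset.filter_subset _ _
    have hdisj : Disjoint L.root.simplices R.root.simplices := by
      rw [hL, hR]
      exact Finset.disjoint_filter_filter_not _ _ _
    have hLon := htL.isOrthogonalised_root.orthonormalList_scaling
      (ihL htL (orthonormal_restrict hχ hLB))
    have hRon := htR.isOrthogonalised_root.orthonormalList_scaling
      (ihR htR (orthonormal_restrict hχ hRB))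
    refine (hLon.append hRon fun x hx y hy => ?_).perm hinput.symm
    exact (isOrtho_cellSpan hχ hLB hRB hdisj).inner_eq
      (htL.isOrthogonalised_root.mem_of_mem_scaling (fun _ => htL.mem_cellSpan_of_mem_input) hx)
      (htR.isOrthogonalised_root.mem_of_mem_scaling (fun _ => htR.mem_cellSpan_of_mem_input) hy)

theorem norm_wavelet_eq_one_and_inner_eq_zero
    {tree : CellTree (Finset (EuclideanSpace ℝ (Fin d))) H}
    (h : IsMultilevelTree n₀ M φ χ tree)
    (hχ : Orthonormal ℝ fun p : tree.root.simplices × Fin q => χ p.1 p.2) {l : ℕ}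
    {B : Cell (Finset (EuclideanSpace ℝ (Fin d))) H} (hB : B ∈ tree.cellsAt l) {ψ : H}
    (hψ : ψ ∈ B.wavelets) : ‖ψ‖ = 1 ∧ ∀ i < M, inner ℝ (φ i) ψ = 0 := by
  obtain ⟨t, ht, rfl, hsub⟩ := h.exists_subtree hB
  have hroot := ht.isOrthogonalised_root
  have hinput := ht.orthonormalList_input (orthonormal_restrict hχ hsub)
  exact ⟨(hroot.orthonormalList_wavelets hinput).2 ψ hψ,
    fun i hi => hroot.inner_wavelet_eq_zero hψ hi⟩

end IsMultilevelTree

/-! ### Second moments of random vectors -/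

section SecondMoment

variable {Ω X H G : Type*} [MeasurableSpace Ω] [MeasurableSpace X] [NormedAddCommGroup H]
  [InnerProductSpace ℝ H] [NormedAddCommGroup G] [NormedSpace ℝ G] {P : Measure Ω} {μ : Measure X}

theorem summable_integral_inner_sq {ι : Type*} {φ : ι → H} (hφ : Orthonormal ℝ φ) {Y : Ω → H}
    (hY : MemLp Y 2 P) : Summable fun i => ∫ ω, inner ℝ (Y ω) (φ i) ^ 2 ∂P := by
  have hint (i : ι) : Integrable (fun ω => inner ℝ (Y ω) (φ i) ^ 2) P :=
    (hY.inner_const (φ i)).integrable_sq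
  refine summable_of_sum_le (c := ∫ ω, ‖Y ω‖ ^ 2 ∂P)
    (fun i => integral_nonneg fun ω => sq_nonneg _) fun s => ?_
  rw [← integral_finsetSum _ fun i _ => hint i]
  refine integral_mono (integrable_finsetSum _ fun i _ => hint i)
    ((memLp_two_iff_integrable_sq_norm hY.1).1 hY) fun ω => ?_
  simpa only [real_inner_comm, Real.norm_eq_abs, sq_abs] using
    hφ.sum_inner_products_le (Y ω) (s := s)

theorem le_tsum_nat_add_of_hasSum_mul_inner_sq {lam : ℕ → ℝ} (hlam : ∀ i, 0 ≤ lam i)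
    (hsum : Summable lam) {φ : ℕ → H} (hφ : ∀ i, ‖φ i‖ ≤ 1) {ψ : H} (hψ : ‖ψ‖ ≤ 1) {M : ℕ}
    (hφψ : ∀ i < M, inner ℝ (φ i) ψ = 0) {a : ℝ}
    (ha : HasSum (fun i => lam i * inner ℝ (φ i) ψ ^ 2) a) : a ≤ ∑' i, lam (M + i) := by
  have hhead : ∑ i ∈ Finset.range M, lam i * inner ℝ (φ i) ψ ^ 2 = 0 :=
    Finset.sum_eq_zero fun i hi => by rw [hφψ i (Finset.mem_range.1 hi)]; ring
  have htail : HasSum (fun i => lam (i + M) * inner ℝ (φ (i + M)) ψ ^ 2) a :=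
    (hasSum_nat_add_iff (f := fun i => lam i * inner ℝ (φ i) ψ ^ 2) M).2
      (by rwa [hhead, add_zero])
  simp only [add_comm M]
  refine hasSum_le (fun i => mul_le_of_le_one_right (hlam _) ?_) htail
    ((summable_nat_add_iff M).2 hsum).hasSum
  exact (sq_le_one_iff_abs_le_one _).2 ((abs_real_inner_le_norm _ _).trans
    (mul_le_one₀ (hφ _) (norm_nonneg ψ) hψ))

theorem integrable_inner_smul_prod {F : Ω × X → H} {u : X → H} {h : Ω → G}
    (hF : MemLp F 2 (P.prod μ)) (hu : MemLp u 2 μ) (hh : MemLp h 2 P) :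
    Integrable (fun z : Ω × X => (inner ℝ (F z) (u z.2) : ℝ) • h z.1) (P.prod μ) := by
  have hu' : AEStronglyMeasurable (fun z : Ω × X => u z.2) (P.prod μ) := hu.1.comp_snd
  have hh' : AEStronglyMeasurable (fun z : Ω × X => h z.1) (P.prod μ) := hh.1.comp_fst
  have huh : MemLp (fun z : Ω × X => ‖h z.1‖ * ‖u z.2‖) 2 (P.prod μ) := by
    refine (memLp_two_iff_integrable_sq (hh'.norm.mul hu'.norm)).2 ?_
    refine (((memLp_two_iff_integrable_sq_norm hh.1).1 hh).mul_prod
      ((memLp_two_iff_integrable_sq_norm hu.1).1 hu)).congr ?_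
    exact ae_of_all _ fun z => (mul_pow _ _ 2).symm
  refine (hF.norm.integrable_mul huh).mono ((hF.1.inner hu').smul hh') (ae_of_all _ fun z => ?_)
  calc ‖(inner ℝ (F z) (u z.2) : ℝ) • h z.1‖
      ≤ ‖F z‖ * ‖u z.2‖ * ‖h z.1‖ := by
        rw [norm_smul]
        gcongr
        exact norm_inner_le_norm _ _
    _ = ‖F z‖ * (‖h z.1‖ * ‖u z.2‖) := by ring
    _ ≤ ‖‖F z‖ * (‖h z.1‖ * ‖u z.2‖)‖ := Real.le_norm_self _

end SecondMoment

/-! ### The covariance operator -/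

section RandomField

variable {Ω : Type*} [MeasurableSpace Ω] {d q : ℕ} {P : Measure Ω}
  {μ : Measure (EuclideanSpace ℝ (Fin d))} {v : Ω → L2 μ q}
  {f : Ω → EuclideanSpace ℝ (Fin d) → EuclideanSpace ℝ (Fin q)}

theorem mean_eq_integral {x : EuclideanSpace ℝ (Fin d)} (hx : Integrable (fun ω => f ω x) P) :
    mean P f x = ∫ ω, f ω x ∂P := by
  ext i
  exact (eval_integral_piLp (fun j => hx.eval_piLp j) i).symm

theorem covFn_apply_of_mean_eq_zero {x y : EuclideanSpace ℝ (Fin d)} (hx : mean P f x = 0)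
    (hy : mean P f y = 0) (i j : Fin q) : covFn P f x y i j = ∫ ω, f ω x i * f ω y j ∂P := by
  have hx' : ∫ ω, f ω x i ∂P = 0 := congrArg (fun w : EuclideanSpace ℝ (Fin q) => w i) hx
  have hy' : ∫ ω, f ω y j ∂P = 0 := congrArg (fun w : EuclideanSpace ℝ (Fin q) => w j) hy
  simp only [covFn, Matrix.of_apply, covariance, hx', hy', sub_zero]

theorem covFn_mulVec_of_mean_eq_zero {x y : EuclideanSpace ℝ (Fin d)}
    (hx : MemLp (fun ω => f ω x) 2 P) (hy : MemLp (fun ω => f ω y) 2 P) (hmx : mean P f x = 0)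
    (hmy : mean P f y = 0) (u : EuclideanSpace ℝ (Fin q)) :
    WithLp.toLp 2 ((covFn P f x y).mulVec u) = ∫ ω, (inner ℝ (f ω y) u : ℝ) • f ω x ∂P := by
  have hyu : MemLp (fun ω => (inner ℝ (f ω y) u : ℝ)) 2 P := hy.inner_const u
  have hint : Integrable (fun ω => (inner ℝ (f ω y) u : ℝ) • f ω x) P :=
    memLp_one_iff_integrable.1 (hx.smul hyu)
  have hprod (i j : Fin q) : Integrable (fun ω => f ω x i * f ω y j * u j) P :=
    ((hx.eval_piLp i).integrable_mul (hy.eval_piLp j)).mul_const (u j)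
  ext i
  calc (covFn P f x y).mulVec u i
      = ∑ j, ∫ ω, f ω x i * f ω y j * u j ∂P := by
        simp only [Matrix.mulVec, dotProduct, covFn_apply_of_mean_eq_zero hmx hmy,
          integral_mul_const]
    _ = ∫ ω, ∑ j, f ω x i * f ω y j * u j ∂P := (integral_finsetSum _ fun j _ => hprod i j).symm
    _ = ∫ ω, ((inner ℝ (f ω y) u : ℝ) • f ω x) i ∂P := by
        congr 1 with ω
        simp only [PiLp.smul_apply, smul_eq_mul, PiLp.inner_apply, RCLike.inner_apply,
          conj_trivial, Finset.sum_mul]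
        exact Finset.sum_congr rfl fun j _ => by ring
    _ = (∫ ω, (inner ℝ (f ω y) u : ℝ) • f ω x ∂P) i :=
        (eval_integral_piLp (fun j => hint.eval_piLp j) i).symm

namespace IsRandomField

theorem inner_eq_integral (hv : IsRandomField P μ v f) (u : L2 μ q) :
    ∀ᵐ ω ∂P, inner ℝ (v ω) u = ∫ x, inner ℝ (f ω x) (u x) ∂μ := by
  filter_upwards [hv.values] with ω hω
  rw [L2.inner_def]
  exact integral_congr_ae (hω.mono fun x hx => by simp only [hx])

variable [SFinite μ]

theorem memLp_uncurry (hv : IsRandomField P μ v f) :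
    MemLp (Function.uncurry f) 2 (P.prod μ) := by
  refine (memLp_two_iff_integrable_sq_norm hv.measurable).2
    ((integrable_prod_iff (hv.measurable.norm.pow 2)).2 ⟨?_, ?_⟩)
  · filter_upwards [hv.values] with ω hω
    have hfω : MemLp (f ω) 2 μ := (Lp.memLp (v ω)).ae_eq hω
    exact (memLp_two_iff_integrable_sq_norm hfω.1).1 hfω
  · refine ((memLp_two_iff_integrable_sq_norm hv.memLp.1).1 hv.memLp).congr ?_
    filter_upwards [hv.values] with ω hω
    rw [← real_inner_self_eq_norm_sq, L2.inner_def]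
    exact integral_congr_ae (hω.mono fun x hx => by simp [hx, Function.uncurry])

section SFinite

variable [SFinite P]

theorem ae_memLp (hv : IsRandomField P μ v f) : ∀ᵐ x ∂μ, MemLp (fun ω => f ω x) 2 P := by
  have hsq : Integrable (fun z => ‖Function.uncurry f z‖ ^ 2) (P.prod μ) :=
    (memLp_two_iff_integrable_sq_norm hv.measurable).1 hv.memLp_uncurry
  filter_upwards [hsq.prod_left_ae, hv.measurable.prod_swap.prodMk_left] with x hsq hmeas
  exact (memLp_two_iff_integrable_sq_norm hmeas).2 hsq

theorem integral_inner_smul {G : Type*} [NormedAddCommGroup G] [NormedSpace ℝ G]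
    [CompleteSpace G] (hv : IsRandomField P μ v f) (u : L2 μ q) {h : Ω → G} (hh : MemLp h 2 P) :
    ∫ ω, (inner ℝ (v ω) u : ℝ) • h ω ∂P =
      ∫ x, ∫ ω, (inner ℝ (f ω x) (u x) : ℝ) • h ω ∂P ∂μ := by
  rw [← integral_integral_swap (f := fun ω x => (inner ℝ (f ω x) (u x) : ℝ) • h ω)
    (integrable_inner_smul_prod hv.memLp_uncurry (Lp.memLp u) hh)]
  refine integral_congr_ae ?_
  filter_upwards [hv.inner_eq_integral u] with ω hω
  rw [hω, integral_smul_const]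

theorem covOp_ae_eq (hv : IsRandomField P μ v f) (hmean : ∀ᵐ x ∂μ, mean P f x = 0) (u : L2 μ q) :
    covOp P μ f u =ᵐ[μ] fun x => ∫ ω, (inner ℝ (v ω) u : ℝ) • f ω x ∂P := by
  filter_upwards [hv.ae_memLp, hmean] with x hx hmx
  rw [hv.integral_inner_smul u hx, covOp]
  refine integral_congr_ae ?_
  filter_upwards [hv.ae_memLp, hmean] with y hy hmy
  exact covFn_mulVec_of_mean_eq_zero hx hy hmx hmy (u y)

theorem inner_eq_integral_of_covOp_ae_eq (hv : IsRandomField P μ v f)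
    (hmean : ∀ᵐ x ∂μ, mean P f x = 0) {u g : L2 μ q} (hg : covOp P μ f u =ᵐ[μ] g) (w : L2 μ q) :
    inner ℝ g w = ∫ ω, inner ℝ (v ω) u * inner ℝ (v ω) w ∂P := by
  have hvu : MemLp (fun ω => inner ℝ (v ω) u) 2 P := hv.memLp.inner_const u
  calc inner ℝ g w
      = ∫ x, ∫ ω, inner ℝ (f ω x) (w x) • inner ℝ (v ω) u ∂P ∂μ := by
        rw [L2.inner_def]
        refine integral_congr_ae ?_
        filter_upwards [hg, hv.covOp_ae_eq hmean u, hv.ae_memLp] with x hgx hux hfx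
        have hint : Integrable (fun ω => (inner ℝ (v ω) u : ℝ) • f ω x) P :=
          memLp_one_iff_integrable.1 (hfx.smul hvu)
        rw [← hgx, hux, real_inner_comm, ← integral_inner hint]
        simp only [inner_smul_right, real_inner_comm, smul_eq_mul, mul_comm]
    _ = ∫ ω, inner ℝ (v ω) u * inner ℝ (v ω) w ∂P := by
        rw [← hv.integral_inner_smul w hvu]
        simp only [smul_eq_mul, mul_comm]

end SFinite

theorem integral_inner_eq_zero [IsFiniteMeasure P] (hv : IsRandomField P μ v f)
    (hmean : ∀ᵐ x ∂μ, mean P f x = 0) (u : L2 μ q) : ∫ ω, inner ℝ (v ω) u ∂P = 0 := by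
  have hfubini := hv.integral_inner_smul u (memLp_const (1 : ℝ))
  simp only [smul_eq_mul, mul_one] at hfubini
  rw [hfubini]
  refine integral_eq_zero_of_ae ?_
  filter_upwards [hmean, hv.ae_memLp] with x hmx hx
  have hint : Integrable (fun ω => f ω x) P := hx.integrable one_le_two
  simp only [real_inner_comm (u x)]
  rw [integral_inner hint, ← mean_eq_integral hint, hmx, inner_zero_right, Pi.zero_apply]

end IsRandomField

namespace IsKLEigensystem

variable {lam : ℕ → ℝ} {φ : ℕ → L2 μ q}

theorem nonempty_coord (hKL : IsKLEigensystem P μ f lam φ) : Nonempty (Fin q) := by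
  by_contra hq
  rw [not_nonempty_iff] at hq
  exact hKL.orthonormal.ne_zero 0 (Lp.ext (ae_of_all _ fun x => Subsingleton.elim _ _))

variable [SFinite P] [SFinite μ]

theorem eigenvalue_eq_integral (hKL : IsKLEigensystem P μ f lam φ) (hv : IsRandomField P μ v f)
    (hmean : ∀ᵐ x ∂μ, mean P f x = 0) (i : ℕ) :
    lam i = ∫ ω, inner ℝ (v ω) (φ i) ^ 2 ∂P := by
  have heigen : covOp P μ f (φ i) =ᵐ[μ] (lam i • φ i : L2 μ q) :=
    (hKL.eigen i).trans (Lp.coeFn_smul (lam i) (φ i)).symm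
  calc lam i = inner ℝ (lam i • φ i) (φ i) := by
        rw [real_inner_smul_left, real_inner_self_eq_norm_sq, hKL.orthonormal.1 i, one_pow, mul_one]
    _ = ∫ ω, inner ℝ (v ω) (φ i) ^ 2 ∂P := by
        simp only [sq, hv.inner_eq_integral_of_covOp_ae_eq hmean heigen]

theorem summable (hKL : IsKLEigensystem P μ f lam φ) (hv : IsRandomField P μ v f)
    (hmean : ∀ᵐ x ∂μ, mean P f x = 0) : Summable lam :=
  (summable_integral_inner_sq hKL.orthonormal hv.memLp).congr
    fun i => (hKL.eigenvalue_eq_integral hv hmean i).symm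

theorem hasSum_integral_inner_sq (hKL : IsKLEigensystem P μ f lam φ) (hv : IsRandomField P μ v f)
    (hmean : ∀ᵐ x ∂μ, mean P f x = 0) (u : L2 μ q) :
    HasSum (fun i => lam i * inner ℝ (φ i) u ^ 2) (∫ ω, inner ℝ (v ω) u ^ 2 ∂P) := by
  obtain ⟨w, hw, hsum⟩ := hKL.spectral u
  have hquad : ∫ ω, inner ℝ (v ω) u ^ 2 ∂P = inner ℝ u w := by
    simp only [sq, real_inner_comm w, hv.inner_eq_integral_of_covOp_ae_eq hmean hw]
  rw [hquad]
  refine (hsum.mapL (innerSL ℝ u)).congr_fun fun i => ?_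
  rw [innerSL_apply_apply, inner_smul_right, real_inner_comm u]
  ring

end IsKLEigensystem

end RandomField

/-! ### Finiteness of the volume -/

theorem IsIndicatorBasis.measure_convexHull_lt_top {d q : ℕ}
    {μ : Measure (EuclideanSpace ℝ (Fin d))} {𝒮 : Finset (Finset (EuclideanSpace ℝ (Fin d)))}
    {c : Finset (EuclideanSpace ℝ (Fin d)) → Fin q → ℝ}
    {χ : Finset (EuclideanSpace ℝ (Fin d)) → Fin q → L2 μ q} (hχ : IsIndicatorBasis 𝒮 c χ)
    [Nonempty (Fin q)] {τ : Finset (EuclideanSpace ℝ (Fin d))} (hτ : τ ∈ 𝒮) :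
    μ (convexHull ℝ (τ : Set (EuclideanSpace ℝ (Fin d)))) < ∞ := by
  obtain ⟨j⟩ := ‹Nonempty (Fin q)›
  have hχτ := hχ.eq_indicator τ hτ j
  have hne : c τ j • EuclideanSpace.single j (1 : ℝ) ≠ 0 := by
    intro hzero
    refine hχ.orthonormal.ne_zero (⟨τ, hτ⟩, j) (Lp.ext ?_)
    rw [hzero, Set.indicator_zero] at hχτ
    exact hχτ.trans (Lp.coeFn_zero _ _ _).symm
  exact SimpleFunc.measure_lt_top_of_memLp_indicator two_ne_zero ENNReal.ofNat_ne_top hne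
    (τ.finite_toSet.isCompact_convexHull ℝ).measurableSet ((Lp.memLp (χ τ j)).ae_eq hχτ)

theorem IsIndicatorBasis.isFiniteMeasure {d q k : ℕ}
    {𝒮 : Finset (Finset (EuclideanSpace ℝ (Fin d)))}
    {c : Finset (EuclideanSpace ℝ (Fin d)) → Fin q → ℝ}
    {χ : Finset (EuclideanSpace ℝ (Fin d)) → Fin q → L2 (domainMeasure k 𝒮) q}
    (hχ : IsIndicatorBasis 𝒮 c χ) [Nonempty (Fin q)] : IsFiniteMeasure (domainMeasure k 𝒮) := by
  refine ⟨?_⟩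
  rw [domainMeasure, Measure.restrict_apply_univ]
  refine measure_biUnion_lt_top 𝒮.finite_toSet fun τ hτ => ?_
  have hτU : convexHull ℝ (τ : Set (EuclideanSpace ℝ (Fin d))) ⊆ domain 𝒮 :=
    fun _ hx => Set.mem_biUnion hτ hx
  have hlt := hχ.measure_convexHull_lt_top hτ
  rwa [domainMeasure, Measure.restrict_eq_self _ hτU] at hlt

end MultilevelKL

theorem mainTheorem6_general {d q : ℕ} {μ : Measure (EuclideanSpace ℝ (Fin d))} [SFinite μ]
    {Ω : Type*} [MeasurableSpace Ω] {P : Measure Ω} [IsFiniteMeasure P]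
    {v : Ω → MultilevelKL.L2 μ q}
    {f : Ω → EuclideanSpace ℝ (Fin d) → EuclideanSpace ℝ (Fin q)}
    (hv : MultilevelKL.IsRandomField P μ v f)
    (hmean : ∀ᵐ x ∂μ, MultilevelKL.mean P f x = 0)
    {lam : ℕ → ℝ} {φ : ℕ → MultilevelKL.L2 μ q} (hKL : MultilevelKL.IsKLEigensystem P μ f lam φ)
    {M n₀ : ℕ} {χ : Finset (EuclideanSpace ℝ (Fin d)) → Fin q → MultilevelKL.L2 μ q}
    {tree : MultilevelKL.CellTree (Finset (EuclideanSpace ℝ (Fin d))) (MultilevelKL.L2 μ q)}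
    (hχ : Orthonormal ℝ fun p : tree.root.simplices × Fin q => χ p.1 p.2)
    (htree : MultilevelKL.IsMultilevelTree n₀ M φ χ tree) :
    Summable (fun i => lam (M + i)) ∧
    ∀ (l : ℕ), ∀ B ∈ tree.cellsAt l, ∀ ψ ∈ B.wavelets, ∀ δ : Ω → ℝ,
      (∀ ω, δ ω = ∫ x, inner ℝ (v ω x) (ψ x) ∂μ) →
      MemLp δ 2 P ∧ ∫ ω, δ ω ∂P = 0 ∧ ∫ ω, δ ω ^ 2 ∂P ≤ ∑' i, lam (M + i) := by
  have hsum : Summable lam := hKL.summable hv hmean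
  refine ⟨hsum.comp_injective (add_right_injective M), fun l B hB ψ hψ δ hδ => ?_⟩
  obtain ⟨hnorm, hφψ⟩ := htree.norm_wavelet_eq_one_and_inner_eq_zero hχ hB hψ
  obtain rfl : δ = fun ω => inner ℝ (v ω) ψ :=
    funext fun ω => (hδ ω).trans (L2.inner_def (𝕜 := ℝ) (v ω) ψ).symm
  exact ⟨hv.memLp.inner_const ψ, hv.integral_inner_eq_zero hmean ψ,
    MultilevelKL.le_tsum_nat_add_of_hasSum_mul_inner_sq hKL.nonneg hsum
      (fun i => (hKL.orthonormal.1 i).le) hnorm.le hφψ (hKL.hasSum_integral_inner_sq hv hmean ψ)⟩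

theorem mainTheorem6 {d q k : ℕ}
    (T : Geometry.SimplicialComplex ℝ (EuclideanSpace ℝ (Fin d)))
    (hT : ∀ τ ∈ T.faces, τ.card ≤ k + 1)
    (S : Finset (Finset (EuclideanSpace ℝ (Fin d))))
    (hS : ∀ τ ∈ S, τ ∈ T.faces ∧ τ.card = k + 1)
    (μ : Measure (EuclideanSpace ℝ (Fin d))) (hμ : μ = MultilevelKL.domainMeasure k S)
    {Ω : Type*} [MeasurableSpace Ω] (P : Measure Ω) [IsProbabilityMeasure P]
    (v : Ω → MultilevelKL.L2 μ q)
    (f : Ω → EuclideanSpace ℝ (Fin d) → EuclideanSpace ℝ (Fin q))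
    (hv : MultilevelKL.IsRandomField P μ v f)
    (hmean : ∀ᵐ x ∂μ, MultilevelKL.mean P f x = 0)
    (lam : ℕ → ℝ) (φ : ℕ → MultilevelKL.L2 μ q)
    (hKL : MultilevelKL.IsKLEigensystem P μ f lam φ)
    (M : ℕ)
    (c : Finset (EuclideanSpace ℝ (Fin d)) → Fin q → ℝ)
    (χ : Finset (EuclideanSpace ℝ (Fin d)) → Fin q → MultilevelKL.L2 μ q)
    (hχ : MultilevelKL.IsIndicatorBasis S c χ)
    (n₀ : ℕ)
    (tree : MultilevelKL.CellTree (Finset (EuclideanSpace ℝ (Fin d))) (MultilevelKL.L2 μ q))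
    (hroot : tree.root.simplices = S)
    (htree : MultilevelKL.IsMultilevelTree n₀ M φ χ tree) :
    Summable (fun i => lam (M + i)) ∧
    ∀ (l : ℕ), ∀ B ∈ tree.cellsAt l, ∀ ψ ∈ B.wavelets, ∀ δ : Ω → ℝ,
      (∀ ω, δ ω = ∫ x, inner ℝ (v ω x) (ψ x) ∂μ) →
      MemLp δ 2 P ∧ ∫ ω, δ ω ∂P = 0 ∧ ∫ ω, δ ω ^ 2 ∂P ≤ ∑' i, lam (M + i) := by
  have := hKL.nonempty_coord
  have : IsFiniteMeasure μ := by subst hμ; exact hχ.isFiniteMeasure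
  exact mainTheorem6_general hv hmean hKL (hroot ▸ hχ.orthonormal) htree
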